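/- Let $\Sigma$ be a finite alphabet. Consider nondeterministic logspace Turing machines with a read-only input tape, work tapes on which only $O(\log n)$ cells are used on inputs of length $n$, and a one-way write-only output tape (not counted towards the space), all of whose computation branches halt. For such a machine and strings $x,y\in\Sigma^\ast$, let $\varphi(x,y)$ be the number of its accepting branches on input $x$ that end with $y$ written on the output tape. For an integer $k\ge 1$, the machine is an $\mathsf{FUL}_k$ machine computing the partial function $f:\Sigma^\ast\rightharpoonup\Sigma^\ast$ if (a) $\varphi(x,f(x))\equiv 1 \pmod k$ for every $x\in\operatorname{dom}(f)$, and (b) $\varphi(x,y)\equiv 0\pmod k$ for every $x\in\operatorname{dom}(f)$ and $y\ne f(x)$, and for every $x\notin\operatorname{dom}(f)$ and every $y\in\Sigma^\ast$. Let $\mathsf{FUL}_k$ be the class of all partial functions $f:\Sigma^\ast\rightharpoonup\Sigma^\ast$ that are computed by some $\mathsf{FUL}_k$ machine. Theorem. Let $k = p_1^{e_1}p_2^{e_2}\cdots p_\ell^{e_\ell}$ be the factorization of an integer $k\ge 2$ into powers of distinct primes, with all $e_j\ge 1$. Then $$\mathsf{FUL}_k=\mathsf{FUL}_{p_1}\cap\mathsf{FUL}_{p_2}\cap\cdots\cap\mathsf{FUL}_{p_\ell},$$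 and in particular $\mathsf{FUL}_k=\mathsf{FUL}_{p_1p_2\cdots p_\ell}$. -/

import Mathlib

namespace ModLog

/-- Head movements. -/
inductive Move : Type
  | left
  | stay
  | right

/-- The new position of a head on a one-way infinite tape with cells `0, 1, 2, …`;
a left move on cell `0` leaves the head where it is. -/
def Move.apply : Move → ℕ → ℕ
  | .left, i => i - 1
  | .stay, i => i
  | .right, i => i + 1

/-- What the input head may see: a letter of the input or one of the two end markers. -/
inductive InputSymbol (α : Type) : Type
  | leftEnd
  | letter (a : α)
  | rightEnd

/-- The content of cell `i` of the input tape holding `⊢ x ⊣`. -/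
def inputAt {α : Type} (x : List α) : ℕ → InputSymbol α
  | 0 => .leftEnd
  | i + 1 =>
    match x[i]? with
    | some a => .letter a
    | none => .rightEnd

/-- The right-hand side of a transition: the new state, the symbols written on the work tapes,
the movements of the heads, and possibly one letter appended to the output tape. -/
structure Action (α Q Γ ι : Type) : Type where
  state : Q
  write : ι → Γ
  workMove : ι → Move
  inputMove : Move
  emit : Option α

/-- A nondeterministic Turing machine with a two-way read-only input tape, finitely many
read-write work tapes (indexed by `ι`), and a one-way write-only output tape; `α` is the
alphabet of the inputs and the outputs, `trans` is the transition relation. -/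
structure NTM (α : Type) : Type 1 where
  Q : Type
  Γ : Type
  ι : Type
  finiteQ : Finite Q
  finiteΓ : Finite Γ
  finiteι : Finite ι
  start : Q
  blank : Γ
  accept : Set Q
  trans : Q → InputSymbol α → (ι → Γ) → Set (Action α Q Γ ι)

namespace NTM

variable {α : Type}

/-- Actions of the machine `M`. -/
abbrev Act (M : NTM α) : Type := Action α M.Q M.Γ M.ι

/-- Configurations of the machine `M` (the input is kept separately). -/
structure Cfg (M : NTM α) : Type where
  state : M.Q
  inputHead : ℕ
  work : M.ι → ℕ → M.Γ
  workHead : M.ι → ℕ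
  output : List α

/-- The initial configuration. -/
def init (M : NTM α) : M.Cfg where
  state := M.start
  inputHead := 0
  work := fun _ _ => M.blank
  workHead := fun _ => 0
  output := []

/-- The transitions that are available on input `x` in the configuration `c`. -/
def enabled (M : NTM α) (x : List α) (c : M.Cfg) : Set M.Act :=
  M.trans c.state (inputAt x c.inputHead) (fun i => c.work i (c.workHead i))

/-- The configuration after the action `a`; the input head never leaves `⊢ x ⊣`. -/
def next (M : NTM α) (x : List α) (c : M.Cfg) (a : M.Act) : M.Cfg where
  state := a.state
  inputHead := min (a.inputMove.apply c.inputHead) (x.length + 1)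
  work := fun i => Function.update (c.work i) (c.workHead i) (a.write i)
  workHead := fun i => (a.workMove i).apply (c.workHead i)
  output := c.output ++ a.emit.toList

/-- `M.Run x c b c'`: on input `x`, the nondeterministic choices listed in `b` are legal and
lead from the configuration `c` to the configuration `c'`. -/
inductive Run (M : NTM α) (x : List α) : M.Cfg → List M.Act → M.Cfg → Prop
  | nil (c : M.Cfg) : Run M x c [] c
  | cons {c c' : M.Cfg} {a : M.Act} {b : List M.Act} (ha : a ∈ M.enabled x c)
      (hb : Run M x (M.next x c a) b c') : Run M x c (a :: b) c'

/-- The branches of the computation of `M` on input `x` that halt in an accepting state with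
the string `y` on the output tape. A branch is the sequence of its nondeterministic choices. -/
def acceptingBranches (M : NTM α) (x y : List α) : Set (List M.Act) :=
  {b | ∃ c : M.Cfg, M.Run x M.init b c ∧ M.enabled x c = ∅ ∧ c.state ∈ M.accept ∧ c.output = y}

/-- The number `φ(x, y)` of accepting branches on input `x` with `y` on the output tape. The set
of these branches is finite for machines that satisfy `Halts`, over a finite alphabet. -/
noncomputable def count (M : NTM α) (x y : List α) : ℕ :=
  (M.acceptingBranches x y).ncard

/-- Every branch of every computation is finite. As the computation tree on a given input is
finitely branching, this is the same as a bound on the lengths of its branches. -/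
def Halts (M : NTM α) : Prop :=
  ∀ x : List α, ∃ T : ℕ, ∀ (b : List M.Act) (c : M.Cfg), M.Run x M.init b c → b.length ≤ T

/-- On inputs of length `n`, in every branch, the work heads stay within the first `O(log n)`
cells. Neither the input tape nor the output tape counts towards the space. -/
def UsesLogSpace (M : NTM α) : Prop :=
  ∃ C : ℕ, ∀ (x : List α) (b : List M.Act) (c : M.Cfg), M.Run x M.init b c →
    ∀ i : M.ι, c.workHead i ≤ C * Nat.log 2 x.length + C

/-- `M` is an `FUL[k]` machine computing the partial function `f`. -/
structure IsFULMachine (M : NTM α) (k : ℕ) (f : List α →. List α) : Prop where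
  halts : M.Halts
  logSpace : M.UsesLogSpace
  count_eq : ∀ x y : List α, y ∈ f x → M.count x y ≡ 1 [MOD k]
  count_ne : ∀ x y : List α, y ∉ f x → M.count x y ≡ 0 [MOD k]

end NTM

/-- The class `FUL[k]` of partial functions on strings over the alphabet `α`. -/
def FUL (α : Type) (k : ℕ) : Set (List α →. List α) :=
  {f | ∃ M : NTM α, M.IsFULMachine k f}

end ModLog

namespace ModLog

/-! Call a function `g x y` a log count (`IsLogCount`) if it is the number of accepting branches of
a halting logspace machine on input `x` with output `y`. By `mem_FUL_iff`, membership in `FUL α k`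
asks for a log count that is 1 modulo `k` on the graph of `f` and 0 modulo `k` off it. The theorem
thus becomes arithmetic, once log counts are known to be closed under sums and products.

A sum is a nondeterministic choice between two machines. A product must run both machines with the
same output. That output may be too long to store, so the machines are run alternately and matched
letter by letter; the single input head is shared by keeping the idle machine's position in a binary
counter. The counting is by induction on computation trees carrying their number of accepting
branches (`Tree`), in `Tree.prod_snd` and `Tree.prod_aux`.

For the arithmetic, let `g j` be a log count for `p j`. Its power with exponent `p j ^ (e j - 1)`
has the same residue 0 or 1, now modulo `p j ^ e j` (`modEq_pow_pow`). With Chinese remainder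
coefficients `c j`, the sum of the terms `c j * g j x y ^ p j ^ (e j - 1)` has that residue modulo
`k`. The other inclusion is reduction modulo a divisor, and the squarefree statement is the case of
exponents 1: both classes equal the same intersection. -/

instance : Finite Move :=
  Finite.of_injective (β := Fin 3) (fun | .left => 0 | .stay => 1 | .right => 2) (by
    rintro (_ | _ | _) (_ | _ | _) h <;> simp_all)

instance {α Q Γ ι : Type} [Finite α] [Finite Q] [Finite Γ] [Finite ι] :
    Finite (Action α Q Γ ι) :=
  Finite.of_injective (β := Q × (ι → Γ) × (ι → Move) × Move × Option α)
    (fun a => (a.state, a.write, a.workMove, a.inputMove, a.emit)) (by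
      rintro ⟨⟩ ⟨⟩ h
      simp_all)

/-! ### Computation trees and the numbers of their accepting branches -/

namespace NTM

variable {α : Type}

attribute [instance] finiteQ finiteΓ finiteι

/-- In the configuration `c` the machine has halted and accepts with output `y`. -/
def AcceptsAt (M : NTM α) (x y : List α) (c : M.Cfg) : Prop :=
  M.enabled x c = ∅ ∧ c.state ∈ M.accept ∧ c.output = y

open Classical in
/-- The contribution of the configuration `c` itself to the number of accepting branches. -/
noncomputable def leafCount (M : NTM α) (x y : List α) (c : M.Cfg) : ℕ :=
  if M.AcceptsAt x y c then 1 else 0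

/-- `M.Tree x y B c v`: on input `x`, the computation tree of `M` below the configuration `c` is
well-founded, on it all work heads stay within the cells `0, …, B`, and it has `v` accepting
branches with output `y`. -/
inductive Tree (M : NTM α) (x y : List α) (B : ℕ) : M.Cfg → ℕ → Prop
  | intro (c : M.Cfg) (w : M.Act → ℕ) (hwork : ∀ i, c.workHead i ≤ B)
      (hinput : c.inputHead ≤ x.length + 1)
      (hnext : ∀ a ∈ M.enabled x c, Tree M x y B (M.next x c a) (w a)) :
      Tree M x y B c (M.leafCount x y c + ∑ᶠ a ∈ M.enabled x c, w a)

/-- The accepting branches that start in the configuration `c`. -/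
def branchesFrom (M : NTM α) (x y : List α) (c : M.Cfg) : Set (List M.Act) :=
  {b | ∃ c' : M.Cfg, M.Run x c b c' ∧ M.AcceptsAt x y c'}

theorem branchesFrom_eq (M : NTM α) (x y : List α) (c : M.Cfg) :
    M.branchesFrom x y c = {b | b = [] ∧ M.AcceptsAt x y c} ∪
      ⋃ a ∈ M.enabled x c, List.cons a '' M.branchesFrom x y (M.next x c a) := by
  ext b
  simp only [branchesFrom, Set.mem_ofPred_eq, Set.mem_union, Set.mem_iUnion, Set.mem_image]
  constructor
  · rintro ⟨c', hr, hc'⟩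
    cases hr with
    | nil => exact .inl ⟨rfl, hc'⟩
    | cons ha hb => exact .inr ⟨_, ha, _, ⟨c', hb, hc'⟩, rfl⟩
  · rintro (⟨rfl, hc⟩ | ⟨a, ha, b, ⟨c', hb, hc'⟩, rfl⟩)
    · exact ⟨c, .nil c, hc⟩
    · exact ⟨c', .cons ha hb, hc'⟩

variable {M : NTM α} {x y : List α} {B : ℕ} {c : M.Cfg} {v : ℕ}

theorem leafCount_of_nonempty (h : (M.enabled x c).Nonempty) : M.leafCount x y c = 0 := by
  rw [leafCount, if_neg]
  exact fun h' => h.ne_empty h'.1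

namespace Tree

theorem work_le (h : M.Tree x y B c v) (i : M.ι) : c.workHead i ≤ B := by
  cases h with | intro _ _ hwork => exact hwork i

theorem input_le (h : M.Tree x y B c v) : c.inputHead ≤ x.length + 1 := by
  cases h with | intro _ _ _ hinput => exact hinput

theorem mono {B' : ℕ} (hB : B ≤ B') (h : M.Tree x y B c v) : M.Tree x y B' c v := by
  induction h with
  | intro c w hwork hinput _ ih => exact .intro c w (fun i => (hwork i).trans hB) hinput ih

/-- A node whose outgoing actions are parametrized injectively. -/
theorem of_image {β : Type} {S : Set β} {f : β → M.Act} (hf : f.Injective) (w : β → ℕ)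
    (hwork : ∀ i, c.workHead i ≤ B) (hinput : c.inputHead ≤ x.length + 1)
    (hS : M.enabled x c = f '' S) (hnext : ∀ s ∈ S, M.Tree x y B (M.next x c (f s)) (w s))
    (hv : v = M.leafCount x y c + ∑ᶠ s ∈ S, w s) : M.Tree x y B c v := by
  -- The weights are carried along the injection `f`; the default 0 off its range is never summed,
  -- as every enabled action lies in the range.
  have h := Tree.intro (y := y) c (Function.extend f w 0) hwork hinput (by
    rw [hS]
    rintro _ ⟨s, hs, rfl⟩
    rw [hf.extend_apply]
    exact hnext s hs)
  rw [hS, finsum_mem_image hf.injOn] at h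
  simp only [hf.extend_apply] at h
  rwa [hv]

theorem of_singleton {a : M.Act} (hwork : ∀ i, c.workHead i ≤ B)
    (hinput : c.inputHead ≤ x.length + 1) (ha : M.enabled x c = {a})
    (hnext : M.Tree x y B (M.next x c a) v) : M.Tree x y B c v := by
  have h := Tree.intro (y := y) c (fun _ => v) hwork hinput (by
    rw [ha]
    rintro _ rfl
    exact hnext)
  rwa [leafCount_of_nonempty (by simp [ha]), ha, finsum_mem_singleton, zero_add] at h

theorem of_halted (hwork : ∀ i, c.workHead i ≤ B) (hinput : c.inputHead ≤ x.length + 1)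
    (hc : M.enabled x c = ∅) : M.Tree x y B c (M.leafCount x y c) := by
  have h := Tree.intro (y := y) c (fun _ => 0) hwork hinput (by simp [hc])
  simpa [hc] using h

/-- The output written so far is a prefix of the final output. -/
theorem eq_zero_of_not_prefix (h : M.Tree x y B c v) (hc : ¬ c.output <+: y) : v = 0 := by
  induction h with
  | intro c w _ _ _ ih =>
    rw [leafCount, if_neg (fun h : M.AcceptsAt x y c => hc (h.2.2 ▸ List.prefix_rfl)), zero_add]
    refine (finsum_mem_congr rfl fun a ha => ?_).trans (finsum_mem_zero _)
    exact ih a ha fun h => hc ((List.prefix_append _ _).trans h)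

theorem run_le (h : M.Tree x y B c v) :
    ∀ {b : List M.Act} {c' : M.Cfg}, M.Run x c b c' → ∀ i, c'.workHead i ≤ B := by
  induction h with
  | intro c w hwork _ _ ih =>
    intro b c' hr
    cases hr with
    | nil => exact hwork
    | cons ha hb => exact ih _ ha hb

theorem exists_length_le [Finite α] (h : M.Tree x y B c v) :
    ∃ T : ℕ, ∀ (b : List M.Act) (c' : M.Cfg), M.Run x c b c' → b.length ≤ T := by
  induction h with
  | intro c w _ _ _ ih =>
    choose T hT using ih
    have := Fintype.ofFinite M.Act
    classical
    let T' : M.Act → ℕ := fun a => if ha : a ∈ M.enabled x c then T a ha else 0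
    refine ⟨∑ a, T' a + 1, fun b c' hr => ?_⟩
    cases hr with
    | nil => simp
    | @cons _ _ a b ha hb =>
      have h1 : b.length ≤ T' a := by simpa [T', ha] using hT a ha b c' hb
      have h2 : T' a ≤ ∑ a, T' a := Finset.single_le_sum (fun _ _ => Nat.zero_le _)
        (Finset.mem_univ a)
      simp only [List.length_cons]
      omega

/-- Accepting branches are sorted by their first action. These classes are disjoint, and finite in
number because the alphabet is finite, so their sizes add up exactly as in `Tree.intro`. -/
theorem branches [Finite α] (h : M.Tree x y B c v) :
    (M.branchesFrom x y c).Finite ∧ (M.branchesFrom x y c).ncard = v := by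
  induction h with
  | intro c w _ _ _ ih =>
    have hfin : ∀ a ∈ M.enabled x c,
        (List.cons a '' M.branchesFrom x y (M.next x c a)).Finite :=
      fun a ha => (ih a ha).1.image _
    have hleaf : {b : List M.Act | b = [] ∧ M.AcceptsAt x y c}.Finite :=
      (Set.finite_singleton []).subset fun b hb => hb.1
    have hE : (M.enabled x c).Finite := Set.toFinite _
    rw [branchesFrom_eq]
    refine ⟨hleaf.union (hE.biUnion hfin), ?_⟩
    rw [Set.ncard_union_eq _ hleaf (hE.biUnion hfin), hE.ncard_biUnion hfin]
    · congr 1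
      · by_cases hc : M.AcceptsAt x y c <;> simp [leafCount, hc]
      · refine finsum_mem_congr rfl fun a ha => ?_
        rw [Set.ncard_image_of_injective _ List.cons_injective, (ih a ha).2]
    · intro a _ a' _ hne
      refine Set.disjoint_left.2 ?_
      rintro _ ⟨b, _, rfl⟩ ⟨b', _, hb'⟩
      exact hne (List.cons.inj hb').1.symm
    · refine Set.disjoint_left.2 ?_
      rintro _ ⟨rfl, _⟩ hb
      simp at hb

theorem count_eq [Finite α] (h : M.Tree x y B M.init v) : M.count x y = v :=
  h.branches.2

end Tree

/-- A bound on the branch lengths makes the computation tree well-founded; the induction is on that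
bound, which drops by one at each child. -/
theorem exists_tree_of_length_le (T : ℕ) :
    ∀ c : M.Cfg, c.inputHead ≤ x.length + 1 →
      (∀ b c', M.Run x c b c' → b.length ≤ T) →
      (∀ b c', M.Run x c b c' → ∀ i, c'.workHead i ≤ B) → ∃ v, M.Tree x y B c v := by
  induction T with
  | zero =>
    intro c hin hT hB
    have hc : M.enabled x c = ∅ := by
      refine Set.eq_empty_iff_forall_notMem.2 fun a ha => ?_
      simpa using hT _ _ (.cons ha (.nil _))
    exact ⟨_, .of_halted (hB _ _ (.nil c)) hin hc⟩
  | succ T ih =>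
    intro c hin hT hB
    have h : ∀ a, ∃ v, a ∈ M.enabled x c → M.Tree x y B (M.next x c a) v := by
      intro a
      by_cases ha : a ∈ M.enabled x c
      · obtain ⟨v, hv⟩ := ih (M.next x c a) (min_le_right _ _)
          (fun b c' hr => by simpa using hT _ _ (.cons ha hr))
          (fun b c' hr => hB _ _ (.cons ha hr))
        exact ⟨v, fun _ => hv⟩
      · exact ⟨0, fun h => absurd h ha⟩
    choose w hw using h
    exact ⟨_, .intro c w (hB _ _ (.nil c)) hin hw⟩

/-- `g` counts the accepting branches of a halting logspace machine. -/
def _root_.ModLog.IsLogCount (g : List α → List α → ℕ) : Prop :=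
  ∃ M : NTM α, ∃ C : ℕ, ∀ x y, M.Tree x y (C * Nat.log 2 x.length + C) M.init (g x y)

theorem isLogCount_count [Finite α] (M : NTM α) (h : M.Halts) (hs : M.UsesLogSpace) :
    IsLogCount M.count := by
  obtain ⟨C, hC⟩ := hs
  refine ⟨M, C, fun x y => ?_⟩
  obtain ⟨T, hT⟩ := h x
  obtain ⟨v, hv⟩ := exists_tree_of_length_le (y := y) T M.init (Nat.zero_le _) hT (hC x)
  rwa [hv.count_eq]

/-- Halting, the space bound and the count can all be read off from the trees, so constructions of
machines only have to produce trees. -/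
theorem _root_.ModLog.IsLogCount.exists_machine [Finite α] {g : List α → List α → ℕ}
    (h : IsLogCount g) : ∃ M : NTM α, M.Halts ∧ M.UsesLogSpace ∧ M.count = g := by
  obtain ⟨M, C, hM⟩ := h
  refine ⟨M, fun x => (hM x []).exists_length_le, ⟨C, fun x b c hr => (hM x []).run_le hr⟩, ?_⟩
  ext x y
  exact (hM x y).count_eq

end NTM

end ModLog

/-! ### Binary counters and the exchange of input heads -/

namespace ModLog

/-- The symbols on a counter tape: whether the cell is marked as cell `0`, and a binary digit. -/
abbrev CounterSymbol : Type := Bool × Option Bool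

/-- The phases of a machine that alternates between the input heads of two simulated machines:
`start` marks the cells `0` of the counters, `run` is a simulation phase, `dead` rejects, and the
others belong to the exchange of the heads. -/
inductive Phase : Type
  | start
  | run
  | dead
  | store
  | inc
  | incRet
  | dec
  | decRet
  | erase

instance : Finite Phase :=
  Finite.of_injective (β := Fin 9) (fun
    | .start => 0 | .run => 1 | .dead => 2 | .store => 3 | .inc => 4 | .incRet => 5
    | .dec => 6 | .decRet => 7 | .erase => 8) (by
    rintro (_ | _) (_ | _) h <;> simp_all)

/-- A step of the exchange of the heads: what is written on the two counters, and how their heads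
and the input head move. -/
structure SwapAction : Type where
  phase : Phase
  writeStore : CounterSymbol
  writeLoad : CounterSymbol
  moveStore : Move
  moveLoad : Move
  inputMove : Move

/-- The program that stores the position of the input head into one binary counter, and then
moves the input head to the position held by another binary counter, which is erased. -/
def swapAction {α : Type} :
    Phase → InputSymbol α → CounterSymbol → CounterSymbol → SwapAction
  | .start, _, r, s => ⟨.run, (true, r.2), (true, s.2), .stay, .stay, .stay⟩
  | .run, _, r, s => ⟨.dead, r, s, .stay, .stay, .stay⟩
  | .dead, _, r, s => ⟨.dead, r, s, .stay, .stay, .stay⟩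
  | .store, .leftEnd, r, s => ⟨.dec, r, s, .stay, .stay, .stay⟩
  | .store, _, r, s => ⟨.inc, r, s, .stay, .stay, .left⟩
  | .inc, _, (m, some true), s => ⟨.inc, (m, some false), s, .right, .stay, .stay⟩
  | .inc, _, (m, _), s => ⟨.incRet, (m, some true), s, .stay, .stay, .stay⟩
  | .incRet, _, (true, d), s => ⟨.store, (true, d), s, .stay, .stay, .stay⟩
  | .incRet, _, (false, d), s => ⟨.incRet, (false, d), s, .left, .stay, .stay⟩
  | .dec, _, r, (m, some false) => ⟨.dec, r, (m, some true), .stay, .right, .stay⟩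
  | .dec, _, r, (m, some true) => ⟨.decRet, r, (m, some false), .stay, .stay, .stay⟩
  | .dec, _, r, (m, none) => ⟨.erase, r, (m, none), .stay, .stay, .stay⟩
  | .decRet, _, r, (true, d) => ⟨.dec, r, (true, d), .stay, .stay, .right⟩
  | .decRet, _, r, (false, d) => ⟨.decRet, r, (false, d), .stay, .left, .stay⟩
  | .erase, _, r, (true, _) => ⟨.run, r, (true, none), .stay, .stay, .stay⟩
  | .erase, _, r, (false, _) => ⟨.erase, r, (false, none), .stay, .left, .stay⟩

/-- The part of a configuration that the exchange of the heads works on. -/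
structure SwapCfg : Type where
  phase : Phase
  pos : ℕ
  store : ℕ → CounterSymbol
  storeHead : ℕ
  load : ℕ → CounterSymbol
  loadHead : ℕ

namespace SwapCfg

variable {α : Type}

/-- The action that is due in the configuration `m` on input `x`. -/
def action (x : List α) (m : SwapCfg) : SwapAction :=
  swapAction m.phase (inputAt x m.pos) (m.store m.storeHead) (m.load m.loadHead)

/-- The configuration after one step. -/
def next (x : List α) (m : SwapCfg) : SwapCfg where
  phase := (m.action x).phase
  pos := min ((m.action x).inputMove.apply m.pos) (x.length + 1)
  store := Function.update m.store m.storeHead (m.action x).writeStore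
  storeHead := (m.action x).moveStore.apply m.storeHead
  load := Function.update m.load m.loadHead (m.action x).writeLoad
  loadHead := (m.action x).moveLoad.apply m.loadHead

/-- `m` is in a phase of deterministic bookkeeping, and its heads are within bounds. -/
structure Busy (x : List α) (B : ℕ) (m : SwapCfg) : Prop where
  ne_run : m.phase ≠ .run
  ne_dead : m.phase ≠ .dead
  pos_le : m.pos ≤ x.length + 1
  storeHead_le : m.storeHead ≤ B
  loadHead_le : m.loadHead ≤ B

/-- Reachability by deterministic bookkeeping within bounds. -/
def Reach (x : List α) (B : ℕ) : SwapCfg → SwapCfg → Prop :=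
  Relation.ReflTransGen fun m m' => m.Busy x B ∧ m.next x = m'

variable {x : List α} {B : ℕ}

theorem Reach.head {m m' m'' : SwapCfg} (hb : m.Busy x B) (hm : m.next x = m')
    (h : Reach x B m' m'') : Reach x B m m'' :=
  Relation.ReflTransGen.head ⟨hb, hm⟩ h

/-- The tape of a counter with binary digits `l`, least significant digit first. -/
def counterTape (l : List Bool) : ℕ → CounterSymbol :=
  fun j => (decide (j = 0), l[j]?)

theorem counterTape_append_cons (l₁ l₂ : List Bool) (b : Bool) :
    counterTape (l₁ ++ b :: l₂) l₁.length = (decide (l₁ = []), some b) := by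
  simp [counterTape]

theorem counterTape_length (l : List Bool) :
    counterTape l l.length = (decide (l = []), none) := by
  simp [counterTape]

theorem update_counterTape (l₁ l₂ : List Bool) (b b' : Bool) :
    Function.update (counterTape (l₁ ++ b :: l₂)) l₁.length (decide (l₁ = []), some b') =
      counterTape (l₁ ++ b' :: l₂) := by
  funext j
  rcases eq_or_ne j l₁.length with rfl | hj
  · simp [counterTape]
  · rw [Function.update_of_ne hj]
    simp only [counterTape, Prod.mk.injEq, true_and]
    rcases lt_or_gt_of_ne hj with h | h
    · simp [List.getElem?_append_left h]
    · obtain ⟨i, hi⟩ : ∃ i, j - l₁.length = i + 1 := ⟨j - l₁.length - 1, by omega⟩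
      rw [List.getElem?_append_right h.le, List.getElem?_append_right h.le, hi]
      simp

theorem update_counterTape_length (l : List Bool) (b : Bool) :
    Function.update (counterTape l) l.length (decide (l = []), some b) =
      counterTape (l ++ [b]) := by
  funext j
  rcases eq_or_ne j l.length with rfl | hj
  · simp [counterTape]
  · rw [Function.update_of_ne hj]
    simp only [counterTape, Prod.mk.injEq, true_and]
    rcases lt_or_gt_of_ne hj with h | h
    · simp [List.getElem?_append_left h]
    · rw [List.getElem?_eq_none h.le, List.getElem?_eq_none]
      simp
      omega

theorem update_counterTape_none (l : List Bool) (j : ℕ) (hj : l.length ≤ j + 1) :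
    Function.update (counterTape l) j (decide (j = 0), none) = counterTape (l.take j) := by
  funext i
  rcases eq_or_ne i j with rfl | hi
  · simp [counterTape]
  · rw [Function.update_of_ne hi]
    simp only [counterTape, Prod.mk.injEq, true_and]
    rcases lt_or_gt_of_ne hi with h | h
    · rw [List.getElem?_take_of_lt h]
    · rw [List.getElem?_eq_none (by omega), List.getElem?_eq_none (by simp; omega)]

/-- Increment of a binary number. -/
def incBits : List Bool → List Bool
  | [] => [true]
  | true :: l => false :: incBits l
  | false :: l => true :: l

theorem incBits_bits (n : ℕ) : incBits n.bits = (n + 1).bits := by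
  induction n using Nat.strong_induction_on with
  | _ n ih =>
    rcases Nat.even_or_odd' n with ⟨k, rfl | rfl⟩
    · rcases Nat.eq_zero_or_pos k with rfl | hk
      · simp [incBits]
      · rw [Nat.bit0_bits k hk.ne', Nat.bit1_bits, incBits]
    · rw [Nat.bit1_bits, incBits, ih k (by omega), show 2 * k + 1 + 1 = 2 * (k + 1) by ring,
        Nat.bit0_bits _ (by omega)]

/-- The value of a list of binary digits. -/
def bitsVal : List Bool → ℕ
  | [] => 0
  | b :: l => b.toNat + 2 * bitsVal l

theorem bitsVal_bits (n : ℕ) : bitsVal n.bits = n := by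
  induction n using Nat.strong_induction_on with
  | _ n ih =>
    rcases Nat.even_or_odd' n with ⟨k, rfl | rfl⟩
    · rcases Nat.eq_zero_or_pos k with rfl | hk
      · simp [bitsVal]
      · rw [Nat.bit0_bits k hk.ne', bitsVal, ih k (by omega)]
        simp
    · rw [Nat.bit1_bits, bitsVal, ih k (by omega)]
      simp [add_comm]

/-- Decrement of a positive binary number, keeping the number of digits. -/
def decBits : List Bool → List Bool
  | [] => []
  | true :: l => false :: l
  | false :: l => true :: decBits l

theorem length_decBits (l : List Bool) : (decBits l).length = l.length := by
  induction l with
  | nil => rfl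
  | cons b l ih => cases b <;> simp [decBits, ih]

theorem bitsVal_decBits {l : List Bool} (h : bitsVal l ≠ 0) :
    bitsVal (decBits l) + 1 = bitsVal l := by
  induction l with
  | nil => simp [bitsVal] at h
  | cons b l ih =>
    cases b
    · have h' : bitsVal l ≠ 0 := by simpa [bitsVal] using h
      have := ih h'
      simp only [decBits, bitsVal, Bool.toNat_true, Bool.toNat_false]
      omega
    · simp [decBits, bitsVal, add_comm]

variable {S L : ℕ → CounterSymbol}

/-- The list `l₁` holds the digits that the carry has already passed, so that the induction can
follow the carry through `l₂`. -/
theorem reach_inc {pos i : ℕ} (hpos : pos ≤ x.length + 1) (hi : i ≤ B) (l₂ : List Bool) :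
    ∀ l₁ : List Bool, l₁.length + l₂.length ≤ B → ∃ j ≤ B,
      Reach x B ⟨.inc, pos, counterTape (l₁ ++ l₂), l₁.length, L, i⟩
        ⟨.incRet, pos, counterTape (l₁ ++ incBits l₂), j, L, i⟩ := by
  induction l₂ with
  | nil =>
    intro l₁ hB
    refine ⟨l₁.length, by simpa using hB, .head ⟨nofun, nofun, hpos, by simpa using hB, hi⟩ ?_ .refl⟩
    simp [next, action, counterTape_length, swapAction, Move.apply, hpos, incBits,
      update_counterTape_length]
  | cons b l₂ ih =>
    intro l₁ hB
    simp only [List.length_cons] at hB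
    have hbusy : Busy x B ⟨.inc, pos, counterTape (l₁ ++ b :: l₂), l₁.length, L, i⟩ :=
      ⟨nofun, nofun, hpos, by simp; omega, hi⟩
    cases b
    · refine ⟨l₁.length, by omega, .head hbusy ?_ .refl⟩
      simp [next, action, counterTape_append_cons, swapAction, Move.apply, hpos, incBits,
        update_counterTape]
    · obtain ⟨j, hj, h⟩ := ih (l₁ ++ [false]) (by simp; omega)
      refine ⟨j, hj, .head hbusy ?_ (by simpa [incBits] using h)⟩
      simp [next, action, counterTape_append_cons, swapAction, Move.apply, hpos,
        update_counterTape]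

/-- The mark on cell 0 tells the machine where to stop, since a left move on cell 0 has no visible
effect. -/
theorem reach_incRet {pos i : ℕ} (hpos : pos ≤ x.length + 1) (hi : i ≤ B) (l : List Bool) (j : ℕ)
    (hj : j ≤ B) : Reach x B ⟨.incRet, pos, counterTape l, j, L, i⟩
        ⟨.store, pos, counterTape l, 0, L, i⟩ := by
  induction j with
  | zero =>
    refine .head ⟨nofun, nofun, hpos, hj, hi⟩ ?_ .refl
    simp [next, action, counterTape, swapAction, Move.apply, hpos]
  | succ j ih =>
    refine .head ⟨nofun, nofun, hpos, hj, hi⟩ ?_ (ih (by omega))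
    simp [next, action, counterTape, swapAction, Move.apply, hpos]

theorem reach_decRet {pos i : ℕ} (hpos : pos + 1 ≤ x.length + 1) (hi : i ≤ B) (l : List Bool)
    (j : ℕ) (hj : j ≤ B) : Reach x B ⟨.decRet, pos, S, i, counterTape l, j⟩
        ⟨.dec, pos + 1, S, i, counterTape l, 0⟩ := by
  induction j with
  | zero =>
    refine .head ⟨nofun, nofun, by simp; omega, hi, hj⟩ ?_ .refl
    simp [next, action, counterTape, swapAction, Move.apply]
    omega
  | succ j ih =>
    refine .head ⟨nofun, nofun, by simp; omega, hi, hj⟩ ?_ (ih (by omega))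
    simp [next, action, counterTape, swapAction, Move.apply]
    omega

theorem reach_erase {pos i : ℕ} (hpos : pos ≤ x.length + 1) (hi : i ≤ B) (j : ℕ) (hj : j ≤ B) :
    ∀ l : List Bool, l.length ≤ j + 1 → Reach x B ⟨.erase, pos, S, i, counterTape l, j⟩
        ⟨.run, pos, S, i, counterTape [], 0⟩ := by
  induction j with
  | zero =>
    intro l hl
    refine .head ⟨nofun, nofun, hpos, hi, hj⟩ ?_ .refl
    have := update_counterTape_none l 0 hl
    simp [next, action, swapAction, Move.apply] at this ⊢
    simpa [counterTape, hpos] using this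
  | succ j ih =>
    intro l hl
    refine .head ⟨nofun, nofun, hpos, hi, hj⟩ ?_ (ih (by omega) (l.take (j + 1)) (by simp))
    have := update_counterTape_none l (j + 1) hl
    simp [next, action, swapAction, Move.apply] at this ⊢
    simpa [counterTape, hpos] using this

theorem reach_dec {pos i : ℕ} (hpos : pos ≤ x.length + 1) (hi : i ≤ B) (l₂ : List Bool) :
    ∀ l₁ : List Bool, l₁.length + l₂.length ≤ B → bitsVal l₂ ≠ 0 → ∃ j ≤ B,
      Reach x B ⟨.dec, pos, S, i, counterTape (l₁ ++ l₂), l₁.length⟩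
        ⟨.decRet, pos, S, i, counterTape (l₁ ++ decBits l₂), j⟩ := by
  induction l₂ with
  | nil => simp [bitsVal]
  | cons b l₂ ih =>
    intro l₁ hB hl
    simp only [List.length_cons] at hB
    have hbusy : Busy x B ⟨.dec, pos, S, i, counterTape (l₁ ++ b :: l₂), l₁.length⟩ :=
      ⟨nofun, nofun, hpos, hi, by simp; omega⟩
    cases b
    · obtain ⟨j, hj, h⟩ := ih (l₁ ++ [true]) (by simp; omega) (by simpa [bitsVal] using hl)
      refine ⟨j, hj, .head hbusy ?_ (by simpa [decBits] using h)⟩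
      simp [next, action, counterTape_append_cons, swapAction, Move.apply, hpos,
        update_counterTape]
    · refine ⟨l₁.length, by omega, .head hbusy ?_ .refl⟩
      simp [next, action, counterTape_append_cons, swapAction, Move.apply, hpos, decBits,
        update_counterTape]

/-- The zero test is a decrement whose borrow runs off the end: it meets a blank instead of a digit
1. The ones left behind are then erased, so the counter is empty for its next use. -/
theorem reach_dec_zero {pos i : ℕ} (hpos : pos ≤ x.length + 1) (hi : i ≤ B) (l₂ : List Bool) :
    ∀ l₁ : List Bool, l₁.length + l₂.length ≤ B → bitsVal l₂ = 0 →
      Reach x B ⟨.dec, pos, S, i, counterTape (l₁ ++ l₂), l₁.length⟩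
        ⟨.run, pos, S, i, counterTape [], 0⟩ := by
  induction l₂ with
  | nil =>
    intro l₁ hB _
    simp only [List.length_nil, add_zero] at hB
    refine .head ⟨nofun, nofun, hpos, hi, hB⟩ ?_ (reach_erase hpos hi l₁.length hB l₁ (by simp))
    simp [next, action, counterTape_length, swapAction, Move.apply, hpos]
  | cons b l₂ ih =>
    intro l₁ hB hl
    simp only [List.length_cons] at hB
    cases b
    · have h := ih (l₁ ++ [true]) (by simp; omega) (by simpa [bitsVal] using hl)
      refine .head ⟨nofun, nofun, hpos, hi, by simp; omega⟩ ?_ (by simpa using h)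
      simp [next, action, counterTape_append_cons, swapAction, Move.apply, hpos,
        update_counterTape]
    · simp [bitsVal] at hl

/-- Each decrement pays for one move of the input head to the right. Decrements leave zeros in the
high digits, so the claim is about any digit list of value `n`, not only `n.bits`. -/
theorem reach_load {i : ℕ} (hi : i ≤ B) (n : ℕ) :
    ∀ (pos : ℕ) (l : List Bool), bitsVal l = n → l.length ≤ B → pos + n ≤ x.length + 1 →
      Reach x B ⟨.dec, pos, S, i, counterTape l, 0⟩ ⟨.run, pos + n, S, i, counterTape [], 0⟩ := by
  induction n with
  | zero =>
    intro pos l hl hB hpos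
    exact reach_dec_zero hpos hi l [] (by simpa using hB) hl
  | succ n ih =>
    intro pos l hl hB hpos
    obtain ⟨j, hj, h⟩ := reach_dec (S := S) (pos := pos) (x := x) (by omega) hi l []
      (by simpa using hB) (by omega)
    have hval := bitsVal_decBits (l := l) (by omega)
    have h' := ih (pos + 1) (decBits l) (by omega) (by rwa [length_decBits]) (by omega)
    rw [add_right_comm] at h'
    exact Relation.ReflTransGen.trans h
      (Relation.ReflTransGen.trans (reach_decRet (by omega) hi _ j hj) h')

theorem inputAt_succ_ne (x : List α) (i : ℕ) : inputAt x (i + 1) ≠ .leftEnd := by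
  simp only [inputAt]
  split <;> simp

/-- Each move of the input head to the left pays for one increment, so the counter value plus the
position is invariant. The counter has at most `(x.length + 1).size` digits, which is where
logarithmic space suffices. -/
theorem reach_store {i : ℕ} (hi : i ≤ B) (hB : (x.length + 1).size ≤ B) (pos : ℕ) :
    ∀ k : ℕ, k + pos ≤ x.length + 1 →
      Reach x B ⟨.store, pos, counterTape k.bits, 0, L, i⟩
        ⟨.dec, 0, counterTape (k + pos).bits, 0, L, i⟩ := by
  induction pos with
  | zero =>
    intro k hk
    refine .head ⟨nofun, nofun, by simp, by simp, hi⟩ ?_ .refl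
    simp [next, action, inputAt, swapAction, Move.apply]
  | succ pos ih =>
    intro k hk
    have hlen : k.bits.length ≤ B :=
      (Nat.size_eq_bits_len k).trans_le ((Nat.size_le_size (by omega)).trans hB)
    have hpos : pos ≤ x.length + 1 := by omega
    obtain ⟨j, hj, h⟩ := reach_inc (L := L) hpos hi k.bits [] (by simpa using hlen)
    have h' := ih (k + 1) (by omega)
    rw [List.nil_append, incBits_bits] at h
    rw [add_right_comm, add_assoc] at h'
    refine .head ⟨nofun, nofun, by simp; omega, by simp, hi⟩ ?_
      (Relation.ReflTransGen.trans h (Relation.ReflTransGen.trans (reach_incRet hpos hi _ j hj) h'))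
    have hne := inputAt_succ_ne x pos
    generalize hs : inputAt x (pos + 1) = s at hne
    cases s with
    | leftEnd => exact absurd rfl hne
    | _ => simp [next, action, hs, swapAction, Move.apply, hpos]

/-- The exchange of the heads. -/
theorem reach_swap {pos pos' : ℕ} (hB : (x.length + 1).size ≤ B) (hpos : pos ≤ x.length + 1)
    (hpos' : pos' ≤ x.length + 1) :
    Reach x B ⟨.store, pos, counterTape [], 0, counterTape pos'.bits, 0⟩
      ⟨.run, pos', counterTape pos.bits, 0, counterTape [], 0⟩ := by
  have h := reach_store (L := counterTape pos'.bits) (Nat.zero_le B) hB pos 0 (by omega)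
  have h' := reach_load (S := counterTape pos.bits) (x := x) (Nat.zero_le B) pos' 0 pos'.bits
    (bitsVal_bits pos')
    ((Nat.size_eq_bits_len pos').trans_le ((Nat.size_le_size hpos').trans hB)) (by omega)
  rw [zero_add] at h h'
  rw [Nat.zero_bits] at h
  exact Relation.ReflTransGen.trans h h'

end SwapCfg

end ModLog

/-! ### Construction of the synchronized product -/

namespace ModLog

namespace NTM

variable {α : Type}

open SwapCfg

/-- Control states of the synchronized product of two machines: their states, what the second
machine has to match (`none` if the first machine is active; `some none` if it must not emit
anything any more), and the phase. -/
structure ProdState (α Q₁ Q₂ : Type) : Type where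
  fst : Q₁
  snd : Q₂
  pending : Option (Option α)
  phase : Phase

instance {Q₁ Q₂ : Type} [Finite α] [Finite Q₁] [Finite Q₂] : Finite (ProdState α Q₁ Q₂) :=
  Finite.of_injective (β := Q₁ × Q₂ × Option (Option α) × Phase)
    (fun q => (q.fst, q.snd, q.pending, q.phase)) (by
      rintro ⟨⟩ ⟨⟩ h
      simp_all)

theorem Cfg.ext_of_eq {M : NTM α} {c c' : M.Cfg} (h1 : c.state = c'.state)
    (h2 : c.inputHead = c'.inputHead) (h3 : ∀ i, c.work i = c'.work i)
    (h4 : ∀ i, c.workHead i = c'.workHead i) (h5 : c.output = c'.output) : c = c' := by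
  cases c
  cases c'
  simp only [Cfg.mk.injEq]
  exact ⟨h1, h2, funext h3, funext h4, h5⟩

section Prod

variable (M₁ M₂ : NTM α)

/-- Control states of the product of `M₁` and `M₂`. -/
abbrev PState : Type := ProdState α M₁.Q M₂.Q

/-- Tape symbols of the product of `M₁` and `M₂`. -/
abbrev PSymbol : Type := M₁.Γ × M₂.Γ × CounterSymbol

/-- Work tapes of the product of `M₁` and `M₂`. -/
abbrev PTape : Type := M₁.ι ⊕ M₂.ι ⊕ Bool

/-- Actions of the product of `M₁` and `M₂`. -/
abbrev PAction : Type := Action α (PState M₁ M₂) (PSymbol M₁ M₂) (PTape M₁ M₂)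

variable {M₁ M₂}

/-- An action of the first machine as an action of the product: the head exchange is started
when a letter is emitted. -/
def liftFst (q : PState M₁ M₂) (r : PTape M₁ M₂ → PSymbol M₁ M₂) (a : M₁.Act) : PAction M₁ M₂ where
  state := ⟨a.state, q.snd, a.emit.map some, if a.emit.isSome then .store else .run⟩
  write
    | .inl i => (a.write i, M₂.blank, false, none)
    | .inr t => r (.inr t)
  workMove
    | .inl i => a.workMove i
    | .inr _ => .stay
  inputMove := a.inputMove
  emit := none

open Classical in
/-- An action of the second machine as an action of the product, where the first one has emitted
`o`. -/
noncomputable def liftSnd (q : PState M₁ M₂) (o : Option α) (r : PTape M₁ M₂ → PSymbol M₁ M₂)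
    (a : M₂.Act) : PAction M₁ M₂ where
  state := ⟨q.fst, a.state, if a.emit.isSome then none else some o,
    if a.emit = none then .run else if a.emit = o then .store else .dead⟩
  write
    | .inr (.inl i) => (M₁.blank, a.write i, false, none)
    | t => r t
  workMove
    | .inr (.inl i) => a.workMove i
    | _ => .stay
  inputMove := a.inputMove
  emit := a.emit

theorem liftFst_injective (q : PState M₁ M₂) (r : PTape M₁ M₂ → PSymbol M₁ M₂) :
    Function.Injective (liftFst q r) := by
  rintro ⟨s, w, m, i, e⟩ ⟨s', w', m', i', e'⟩ h
  simp only [liftFst, Action.mk.injEq, ProdState.mk.injEq, true_and, and_true] at h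
  obtain ⟨⟨hs, he, -⟩, hw, hm, hi⟩ := h
  have he := Option.map_injective (Option.some_injective α) he
  have hw : w = w' := funext fun k => congrArg Prod.fst (congrFun hw (.inl k))
  have hm : m = m' := funext fun k => congrFun hm (.inl k)
  subst hs he hw hm hi
  rfl

theorem liftSnd_injective (q : PState M₁ M₂) (o : Option α) (r : PTape M₁ M₂ → PSymbol M₁ M₂) :
    Function.Injective (liftSnd q o r) := by
  rintro ⟨s, w, m, i, e⟩ ⟨s', w', m', i', e'⟩ h
  simp only [liftSnd, Action.mk.injEq, ProdState.mk.injEq, true_and] at h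
  obtain ⟨⟨hs, -, -⟩, hw, hm, hi, he⟩ := h
  have hw : w = w' := funext fun k => congrArg (fun t => t.2.1) (congrFun hw (.inr (.inl k)))
  have hm : m = m' := funext fun k => congrFun hm (.inr (.inl k))
  subst hs he hw hm hi
  rfl

/-- The first machine has halted and accepts: the second machine must not emit any more. -/
def haltFst (q : PState M₁ M₂) (r : PTape M₁ M₂ → PSymbol M₁ M₂) : PAction M₁ M₂ where
  state := ⟨q.fst, q.snd, some none, .store⟩
  write := r
  workMove := fun _ => .stay
  inputMove := .stay
  emit := none

/-- A step of the exchange of heads as an action of the product. The counter that is loaded is the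
one with index `q.pending.isSome`, which belongs to the machine that is to be continued. -/
def liftSwap (q : PState M₁ M₂) (r : PTape M₁ M₂ → PSymbol M₁ M₂) (a : SwapAction) :
    PAction M₁ M₂ where
  state := ⟨q.fst, q.snd, q.pending, a.phase⟩
  write
    | .inr (.inr t) =>
      (M₁.blank, M₂.blank, if t = q.pending.isSome then a.writeLoad else a.writeStore)
    | t => r t
  workMove
    | .inr (.inr t) => if t = q.pending.isSome then a.moveLoad else a.moveStore
    | _ => .stay
  inputMove := a.inputMove
  emit := none

/-- Transitions of the product in a phase of simulation. -/
def prodRun (q : PState M₁ M₂) (s : InputSymbol α) (r : PTape M₁ M₂ → PSymbol M₁ M₂) :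
    Set (PAction M₁ M₂) :=
  match q.pending with
  | none => liftFst q r '' M₁.trans q.fst s (fun i => (r (.inl i)).1) ∪
      {a | M₁.trans q.fst s (fun i => (r (.inl i)).1) = ∅ ∧ q.fst ∈ M₁.accept ∧ a = haltFst q r}
  | some o => liftSnd q o r '' M₂.trans q.snd s (fun i => (r (.inr (.inl i))).2.1)

/-- Transitions of the product. -/
def prodTrans (q : PState M₁ M₂) (s : InputSymbol α) (r : PTape M₁ M₂ → PSymbol M₁ M₂) :
    Set (PAction M₁ M₂) :=
  match q.phase with
  | .run => prodRun q s r
  | .dead => ∅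
  | p => {liftSwap q r (swapAction p s (r (.inr (.inr !q.pending.isSome))).2.2
      (r (.inr (.inr q.pending.isSome))).2.2)}

variable (M₁ M₂) in
/-- The synchronized product of two machines. It runs the first machine until that emits a letter
or accepts, then the second one until that does the same, and so on. -/
def prod [Finite α] : NTM α where
  Q := PState M₁ M₂
  Γ := PSymbol M₁ M₂
  ι := PTape M₁ M₂
  finiteQ := inferInstance
  finiteΓ := inferInstance
  finiteι := inferInstance
  start := ⟨M₁.start, M₂.start, none, .start⟩
  blank := (M₁.blank, M₂.blank, false, none)
  accept := {q | q.phase = .run ∧ q.pending = some none ∧ q.snd ∈ M₂.accept}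
  trans := prodTrans

variable [Finite α]

/-- The configuration of the product in which the two machines have the configurations `c₁` and
`c₂`, apart from their input heads and their outputs. -/
def prodCfg (p : Option (Option α)) (m : SwapCfg) (c₁ : M₁.Cfg) (c₂ : M₂.Cfg) (y : List α) :
    (prod M₁ M₂).Cfg where
  state := (⟨c₁.state, c₂.state, p, m.phase⟩ : PState M₁ M₂)
  inputHead := m.pos
  work
    | .inl i => fun j => (c₁.work i j, M₂.blank, false, none)
    | .inr (.inl i) => fun j => (M₁.blank, c₂.work i j, false, none)
    | .inr (.inr t) => fun j => (M₁.blank, M₂.blank, if t = p.isSome then m.load j else m.store j)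
  workHead
    | .inl i => c₁.workHead i
    | .inr (.inl i) => c₂.workHead i
    | .inr (.inr t) => if t = p.isSome then m.loadHead else m.storeHead
  output := y

variable {x y z : List α} {B : ℕ} {c₁ : M₁.Cfg} {c₂ : M₂.Cfg} {p : Option (Option α)} {v : ℕ}

/-- The symbols that the product reads in a configuration. -/
def prodRead (p : Option (Option α)) (m : SwapCfg) (c₁ : M₁.Cfg) (c₂ : M₂.Cfg) :
    PTape M₁ M₂ → PSymbol M₁ M₂ :=
  fun i => (prodCfg p m c₁ c₂ []).work i ((prodCfg p m c₁ c₂ []).workHead i)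

theorem enabled_prodCfg (m : SwapCfg) :
    (prod M₁ M₂).enabled x (prodCfg p m c₁ c₂ z) =
      prodTrans ⟨c₁.state, c₂.state, p, m.phase⟩ (inputAt x m.pos) (prodRead p m c₁ c₂) :=
  rfl

theorem enabled_prodCfg_swap {m : SwapCfg} (h : m.Busy x B) :
    (prod M₁ M₂).enabled x (prodCfg p m c₁ c₂ z) =
      {liftSwap ⟨c₁.state, c₂.state, p, m.phase⟩ (prodRead p m c₁ c₂) (m.action x)} := by
  have hl : (prodRead p m c₁ c₂ (.inr (.inr p.isSome))).2.2 = m.load m.loadHead := by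
    simp [prodRead, prodCfg]
  have hs : (prodRead p m c₁ c₂ (.inr (.inr !p.isSome))).2.2 = m.store m.storeHead := by
    cases p <;> simp [prodRead, prodCfg]
  rw [enabled_prodCfg, SwapCfg.action, ← hl, ← hs]
  generalize prodRead p m c₁ c₂ = r
  have h1 := h.ne_run
  have h2 := h.ne_dead
  cases hm : m.phase <;> first | contradiction | rfl

theorem next_prodCfg_swap (m : SwapCfg) :
    (prod M₁ M₂).next x (prodCfg p m c₁ c₂ z)
      (liftSwap ⟨c₁.state, c₂.state, p, m.phase⟩ (prodRead p m c₁ c₂) (m.action x)) =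
      prodCfg p (m.next x) c₁ c₂ z := by
  refine Cfg.ext_of_eq rfl rfl (fun (i : PTape M₁ M₂) => ?_) (fun (i : PTape M₁ M₂) => ?_)
    (List.append_nil _)
  · rcases i with i | i | t
    · exact Function.update_eq_self _ _
    · exact Function.update_eq_self _ _
    · cases p <;> cases t <;>
        exact (Function.comp_update (fun s => (M₁.blank, M₂.blank, s)) _ _ _).symm
  · rcases i with i | i | t
    · rfl
    · rfl
    · cases p <;> cases t <;> rfl

theorem workHead_prodCfg_le {m : SwapCfg} (h₁ : ∀ i, c₁.workHead i ≤ B)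
    (h₂ : ∀ i, c₂.workHead i ≤ B) (hs : m.storeHead ≤ B) (hl : m.loadHead ≤ B)
    (i : (prod M₁ M₂).ι) : (prodCfg p m c₁ c₂ z).workHead i ≤ B := by
  rcases (i : PTape M₁ M₂) with i | i | t
  · exact h₁ i
  · exact h₂ i
  · by_cases ht : t = p.isSome <;> simpa [prodCfg, ht]

/-- Bookkeeping does not change the number of accepting branches. -/
theorem Tree.of_reach {m m' : SwapCfg} (hr : m.Reach x B m') (h₁ : ∀ i, c₁.workHead i ≤ B)
    (h₂ : ∀ i, c₂.workHead i ≤ B) (h : (prod M₁ M₂).Tree x y B (prodCfg p m' c₁ c₂ z) v) :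
    (prod M₁ M₂).Tree x y B (prodCfg p m c₁ c₂ z) v := by
  induction hr using Relation.ReflTransGen.head_induction_on with
  | refl => exact h
  | head hm _ ih =>
    obtain ⟨hb, rfl⟩ := hm
    refine .of_singleton (workHead_prodCfg_le h₁ h₂ hb.storeHead_le hb.loadHead_le) hb.pos_le
      (enabled_prodCfg_swap hb) ?_
    rwa [next_prodCfg_swap]

/-- The bookkeeping part of the configuration when the active machine has its input head at `i`,
and the other one at `j`. -/
def atRest (i j : ℕ) : SwapCfg where
  phase := .run
  pos := i
  store := counterTape j.bits
  storeHead := 0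
  load := counterTape []
  loadHead := 0

/-- The same at the beginning of the exchange of the heads, the active machine being the one that
is to be continued. -/
def beforeSwap (i j : ℕ) : SwapCfg where
  phase := .store
  pos := j
  store := counterTape []
  storeHead := 0
  load := counterTape i.bits
  loadHead := 0

theorem Tree.of_swap {i j : ℕ} (hB : (x.length + 1).size ≤ B) (hi : i ≤ x.length + 1)
    (hj : j ≤ x.length + 1) (h₁ : ∀ i, c₁.workHead i ≤ B) (h₂ : ∀ i, c₂.workHead i ≤ B)
    (h : (prod M₁ M₂).Tree x y B (prodCfg p (atRest i j) c₁ c₂ z) v) :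
    (prod M₁ M₂).Tree x y B (prodCfg p (beforeSwap i j) c₁ c₂ z) v :=
  .of_reach (reach_swap hB hj hi) h₁ h₂ h

theorem enabled_prodCfg_fst {i j : ℕ} (h : (M₁.enabled x c₁).Nonempty)
    (hi : i = c₁.inputHead) :
    (prod M₁ M₂).enabled x (prodCfg none (atRest i j) c₁ c₂ z) =
      liftFst ⟨c₁.state, c₂.state, none, .run⟩ (prodRead none (atRest i j) c₁ c₂) ''
        M₁.enabled x c₁ := by
  subst hi
  have h' : M₁.trans c₁.state (inputAt x c₁.inputHead) (fun i => c₁.work i (c₁.workHead i)) ≠ ∅ :=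
    h.ne_empty
  rw [enabled_prodCfg]
  simp only [prodTrans, atRest, prodRun]
  simp only [prodRead, prodCfg, h', false_and, Set.ofPred_false, Set.union_empty]
  rfl

theorem enabled_prodCfg_halted {i j : ℕ} (h : M₁.enabled x c₁ = ∅) (hi : i = c₁.inputHead) :
    (prod M₁ M₂).enabled x (prodCfg none (atRest i j) c₁ c₂ z) =
      {a | c₁.state ∈ M₁.accept ∧
        a = haltFst ⟨c₁.state, c₂.state, none, .run⟩ (prodRead none (atRest i j) c₁ c₂)} := by
  subst hi
  have h' : M₁.trans c₁.state (inputAt x c₁.inputHead) (fun i => c₁.work i (c₁.workHead i)) = ∅ :=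
    h
  rw [enabled_prodCfg]
  simp only [prodTrans, atRest, prodRun]
  simp only [prodRead, prodCfg, h', true_and, Set.image_empty, Set.empty_union]
  rfl

theorem enabled_prodCfg_snd {i j : ℕ} {o : Option α} (hi : i = c₂.inputHead) :
    (prod M₁ M₂).enabled x (prodCfg (some o) (atRest i j) c₁ c₂ z) =
      liftSnd ⟨c₁.state, c₂.state, some o, .run⟩ o (prodRead (some o) (atRest i j) c₁ c₂) ''
        M₂.enabled x c₂ := by
  subst hi
  rfl

/-- An emitted letter flips `isSome` of the pending component, on which the roles of the counters
depend. The counter with the idle head `j` thereby becomes the one to be loaded, without any change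
to the tapes. -/
theorem next_liftFst {i j : ℕ} {a : M₁.Act} (hi : i = c₁.inputHead) :
    (prod M₁ M₂).next x (prodCfg none (atRest i j) c₁ c₂ z)
      (liftFst ⟨c₁.state, c₂.state, none, .run⟩ (prodRead none (atRest i j) c₁ c₂) a) =
      prodCfg (a.emit.map some)
        (if a.emit.isSome then beforeSwap j (M₁.next x c₁ a).inputHead
          else atRest (M₁.next x c₁ a).inputHead j) (M₁.next x c₁ a) c₂ z := by
  subst hi
  obtain ⟨s, w, m, k, e⟩ := a
  refine Cfg.ext_of_eq ?_ ?_ (fun (i : PTape M₁ M₂) => ?_) (fun (i : PTape M₁ M₂) => ?_)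
    (List.append_nil _)
  · cases e <;> rfl
  · cases e <;> rfl
  · rcases i with i | i | t
    · exact (Function.comp_update (fun s => (s, M₂.blank, false, none)) _ _ _).symm
    · exact Function.update_eq_self _ _
    · refine (Function.update_eq_self _ _).trans ?_
      cases e <;> cases t <;> rfl
  · rcases i with i | i | t
    · rfl
    · rfl
    · cases e <;> cases t <;> rfl

theorem next_haltFst {i j : ℕ} :
    (prod M₁ M₂).next x (prodCfg none (atRest i j) c₁ c₂ z)
      (haltFst ⟨c₁.state, c₂.state, none, .run⟩ (prodRead none (atRest i j) c₁ c₂)) =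
      prodCfg (some none) (beforeSwap j (min i (x.length + 1))) c₁ c₂ z := by
  refine Cfg.ext_of_eq rfl rfl (fun (i : PTape M₁ M₂) => ?_) (fun (i : PTape M₁ M₂) => ?_)
    (List.append_nil _)
  · refine (Function.update_eq_self _ _).trans ?_
    rcases i with i | i | (_ | _) <;> rfl
  · rcases i with i | i | (_ | _) <;> rfl

theorem next_liftSnd_none {i j : ℕ} {o : Option α} {a : M₂.Act} (hi : i = c₂.inputHead)
    (ha : a.emit = none) :
    (prod M₁ M₂).next x (prodCfg (some o) (atRest i j) c₁ c₂ c₂.output)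
      (liftSnd ⟨c₁.state, c₂.state, some o, .run⟩ o (prodRead (some o) (atRest i j) c₁ c₂) a) =
      prodCfg (some o) (atRest (M₂.next x c₂ a).inputHead j) c₁ (M₂.next x c₂ a)
        (M₂.next x c₂ a).output := by
  subst hi
  obtain ⟨s, w, m, k, e⟩ := a
  subst ha
  refine Cfg.ext_of_eq ?_ rfl (fun (i : PTape M₁ M₂) => ?_) (fun (i : PTape M₁ M₂) => ?_) rfl
  · simp [NTM.next, prodCfg, liftSnd, atRest]
    rfl
  · rcases i with i | i | t
    · exact Function.update_eq_self _ _
    · exact (Function.comp_update (fun s => (M₁.blank, s, false, none)) _ _ _).symm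
    · exact Function.update_eq_self _ _
  · rcases i with i | i | t <;> rfl

theorem next_liftSnd_some {i j : ℕ} {l : α} {a : M₂.Act} (hi : i = c₂.inputHead)
    (ha : a.emit = some l) :
    (prod M₁ M₂).next x (prodCfg (some (some l)) (atRest i j) c₁ c₂ c₂.output)
      (liftSnd ⟨c₁.state, c₂.state, some (some l), .run⟩ (some l)
        (prodRead (some (some l)) (atRest i j) c₁ c₂) a) =
      prodCfg none (beforeSwap j (M₂.next x c₂ a).inputHead) c₁ (M₂.next x c₂ a)
        (M₂.next x c₂ a).output := by
  subst hi
  obtain ⟨s, w, m, k, e⟩ := a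
  subst ha
  refine Cfg.ext_of_eq ?_ rfl (fun (i : PTape M₁ M₂) => ?_) (fun (i : PTape M₁ M₂) => ?_) rfl
  · simp [NTM.next, prodCfg, liftSnd, beforeSwap]
    rfl
  · rcases i with i | i | t
    · exact Function.update_eq_self _ _
    · exact (Function.comp_update (fun s => (M₁.blank, s, false, none)) _ _ _).symm
    · refine (Function.update_eq_self _ _).trans ?_
      cases t <;> rfl
  · rcases i with i | i | (_ | _) <;> rfl

theorem next_liftSnd_ne {i j : ℕ} {o : Option α} {a : M₂.Act} (hi : i = c₂.inputHead)
    (ha : a.emit ≠ none) (hao : a.emit ≠ o) :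
    ∃ m : SwapCfg, m.phase = .dead ∧ m.pos ≤ x.length + 1 ∧ m.storeHead = 0 ∧ m.loadHead = 0 ∧
    (prod M₁ M₂).next x (prodCfg (some o) (atRest i j) c₁ c₂ z)
      (liftSnd ⟨c₁.state, c₂.state, some o, .run⟩ o (prodRead (some o) (atRest i j) c₁ c₂) a) =
      prodCfg none m c₁ (M₂.next x c₂ a) (z ++ a.emit.toList) := by
  subst hi
  obtain ⟨s, w, m, k, e⟩ := a
  refine ⟨⟨.dead, (M₂.next x c₂ ⟨s, w, m, k, e⟩).inputHead, counterTape [], 0,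
    counterTape j.bits, 0⟩, rfl, min_le_right _ _, rfl, rfl, ?_⟩
  obtain ⟨l, rfl⟩ := Option.ne_none_iff_exists'.1 ha
  have hao' : some l ≠ o := hao
  refine Cfg.ext_of_eq ?_ rfl (fun (i : PTape M₁ M₂) => ?_) (fun (i : PTape M₁ M₂) => ?_) rfl
  · simp [NTM.next, prodCfg, liftSnd, hao']
    rfl
  · rcases i with i | i | t
    · exact Function.update_eq_self _ _
    · exact (Function.comp_update (fun s => (M₁.blank, s, false, none)) _ _ _).symm
    · refine (Function.update_eq_self _ _).trans ?_
      cases t <;> rfl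
  · rcases i with i | i | (_ | _) <;> rfl

end Prod

end NTM

end ModLog

/-! ### Accepting branches of the product are pairs of accepting branches -/

namespace ModLog

namespace NTM

variable {α : Type}

open SwapCfg

theorem Tree.eq_leafCount {M : NTM α} {x y : List α} {B : ℕ} {c : M.Cfg} {v : ℕ}
    (h : M.Tree x y B c v) (hc : M.enabled x c = ∅) : v = M.leafCount x y c := by
  cases h with
  | intro _ w => simp [hc]

section Prod

variable [Finite α] {M₁ M₂ : NTM α} {x y z : List α} {B : ℕ} {c₁ : M₁.Cfg} {v₁ : ℕ}

theorem Tree.of_dead {m : SwapCfg} {p : Option (Option α)} {c₂ : M₂.Cfg}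
    (hm : m.phase = .dead) (hpos : m.pos ≤ x.length + 1) (h₁ : ∀ i, c₁.workHead i ≤ B)
    (h₂ : ∀ i, c₂.workHead i ≤ B) (hs : m.storeHead = 0) (hl : m.loadHead = 0) :
    (prod M₁ M₂).Tree x y B (prodCfg p m c₁ c₂ z) 0 := by
  have he : (prod M₁ M₂).enabled x (prodCfg p m c₁ c₂ z) = ∅ := by
    rw [enabled_prodCfg, hm]
    rfl
  have h := Tree.of_halted (y := y) (B := B)
    (workHead_prodCfg_le h₁ h₂ (hs.trans_le (Nat.zero_le _)) (hl.trans_le (Nat.zero_le _)))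
    hpos he
  rwa [leafCount, if_neg] at h
  rintro ⟨-, h, -⟩
  have : m.phase = .run := h.1
  rw [hm] at this
  cases this

/-- The product while the second machine is active. -/
theorem Tree.prod_snd (hB : (x.length + 1).size ≤ B) (h₁ : M₁.Tree x y B c₁ v₁) (o : Option α)
    (hA : ∀ (c₂ : M₂.Cfg) (v₂ : ℕ), o ≠ none → M₂.Tree x y B c₂ v₂ → c₁.output = c₂.output →
      (prod M₁ M₂).Tree x y B
        (prodCfg none (atRest c₁.inputHead c₂.inputHead) c₁ c₂ c₂.output) (v₁ * v₂))
    (ho : o = none → M₁.enabled x c₁ = ∅ ∧ c₁.state ∈ M₁.accept) {c₂ : M₂.Cfg} {v₂ : ℕ}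
    (h₂ : M₂.Tree x y B c₂ v₂) (hout : c₁.output = c₂.output ++ o.toList) :
    (prod M₁ M₂).Tree x y B
      (prodCfg (some o) (atRest c₂.inputHead c₁.inputHead) c₁ c₂ c₂.output) (v₁ * v₂) := by
  induction h₂ with
  | intro c₂ w hwork hinput hnext ih =>
    refine .of_image (liftSnd_injective _ _ _) (fun a => v₁ * w a)
      (workHead_prodCfg_le h₁.work_le hwork (Nat.zero_le _) (Nat.zero_le _)) hinput
      (enabled_prodCfg_snd rfl) (fun a ha => ?_) ?_
    · by_cases hn : a.emit = none
      · rw [next_liftSnd_none rfl hn]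
        exact ih a ha (by simpa [NTM.next, hn] using hout)
      by_cases hao : a.emit = o
      · obtain ⟨l, rfl⟩ := Option.ne_none_iff_exists'.1 (hao ▸ hn)
        rw [next_liftSnd_some rfl hao]
        refine .of_swap hB h₁.input_le (hnext a ha).input_le h₁.work_le (hnext a ha).work_le ?_
        exact hA _ _ nofun (hnext a ha) (by simpa [NTM.next, hao] using hout)
      · obtain ⟨m, hm, hpos, hs, hl, hnx⟩ := next_liftSnd_ne (c₁ := c₁) (j := c₁.inputHead)
          (z := c₂.output) (x := x) rfl hn hao
        rw [hnx]
        -- Killing a mismatched branch loses nothing: if both factors were nonzero, both outputs so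
        -- far would be prefixes of `y`, with different letters at the same place. For `o = none`,
        -- the first output would be all of `y` and the second one longer.
        have hzero : v₁ * w a = 0 := by
          by_contra hne
          obtain ⟨hv₁, hw⟩ := mul_ne_zero_iff.1 hne
          have hp₂ : c₂.output ++ a.emit.toList <+: y := by
            by_contra hp
            exact hw ((hnext a ha).eq_zero_of_not_prefix hp)
          obtain ⟨l', hl'⟩ := Option.ne_none_iff_exists'.1 hn
          rw [hl', Option.toList_some] at hp₂
          cases o with
          | none =>
            rw [h₁.eq_leafCount (ho rfl).1, leafCount] at hv₁
            have hy : c₁.output = y := (of_not_not fun h => hv₁ (if_neg h) :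
              M₁.AcceptsAt x y c₁).2.2
            rw [← hy, hout] at hp₂
            simpa using hp₂.length_le
          | some l =>
            have hp₁ : c₂.output ++ [l] <+: y := by
              by_contra hp
              exact hv₁ (h₁.eq_zero_of_not_prefix (by rwa [hout]))
            have := (List.prefix_of_prefix_length_le hp₁ hp₂ (by simp)).eq_of_length (by simp)
            rw [hl'] at hao
            exact hao (by simpa using this.symm)
        simp only [hzero]
        exact .of_dead hm hpos h₁.work_le (hnext a ha).work_le hs hl
    · rw [mul_add, mul_finsum_mem]
      congr 1
      have hE : (prod M₁ M₂).enabled x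
          (prodCfg (some o) (atRest c₂.inputHead c₁.inputHead) c₁ c₂ c₂.output) = ∅ ↔
          M₂.enabled x c₂ = ∅ := by
        rw [enabled_prodCfg_snd rfl]
        exact Set.image_eq_empty
      have hacc : (prod M₁ M₂).AcceptsAt x y
          (prodCfg (some o) (atRest c₂.inputHead c₁.inputHead) c₁ c₂ c₂.output) ↔
          o = none ∧ M₂.AcceptsAt x y c₂ := by
        rw [AcceptsAt, hE]
        constructor
        · rintro ⟨h, ⟨-, ho, hs⟩, hy⟩
          exact ⟨Option.some.inj ho, h, hs, hy⟩
        · rintro ⟨rfl, h, hs, hy⟩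
          exact ⟨h, ⟨rfl, rfl, hs⟩, hy⟩
      by_cases h2 : M₂.AcceptsAt x y c₂
      · cases o with
        | none =>
          have h1 : M₁.AcceptsAt x y c₁ :=
            ⟨(ho rfl).1, (ho rfl).2, by simpa [h2.2.2] using hout⟩
          rw [h₁.eq_leafCount (ho rfl).1]
          simp [leafCount, hacc, h1, h2]
        | some l =>
          -- The second machine stops at `y` while the first has already written one letter more.
          have hv : v₁ = 0 := by
            refine h₁.eq_zero_of_not_prefix fun hp => ?_
            rw [hout, h2.2.2] at hp
            simpa using hp.length_le
          simp [leafCount, hacc, hv]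
      · simp [leafCount, hacc, h2]

/-- The product, while the first or the second machine is active. -/
theorem Tree.prod_aux (hB : (x.length + 1).size ≤ B) (h₁ : M₁.Tree x y B c₁ v₁) :
    (∀ (c₂ : M₂.Cfg) (v₂ : ℕ), M₂.Tree x y B c₂ v₂ → c₁.output = c₂.output →
      (prod M₁ M₂).Tree x y B
        (prodCfg none (atRest c₁.inputHead c₂.inputHead) c₁ c₂ c₂.output) (v₁ * v₂)) ∧
    ∀ (l : α) (c₂ : M₂.Cfg) (v₂ : ℕ), M₂.Tree x y B c₂ v₂ → c₁.output = c₂.output ++ [l] →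
      (prod M₁ M₂).Tree x y B
        (prodCfg (some (some l)) (atRest c₂.inputHead c₁.inputHead) c₁ c₂ c₂.output)
        (v₁ * v₂) := by
  induction h₁ with
  | intro c₁ w hwork hinput hnext ih =>
    have h₁ : M₁.Tree x y B c₁ _ := .intro c₁ w hwork hinput hnext
    -- The first claim at `c₁` needs both claims only at children of `c₁`; the second claim at `c₁`
    -- then uses the first one for arbitrary `c₂`.
    have hA : ∀ (c₂ : M₂.Cfg) (v₂ : ℕ), M₂.Tree x y B c₂ v₂ → c₁.output = c₂.output →
        (prod M₁ M₂).Tree x y B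
          (prodCfg none (atRest c₁.inputHead c₂.inputHead) c₁ c₂ c₂.output)
          ((M₁.leafCount x y c₁ + ∑ᶠ a ∈ M₁.enabled x c₁, w a) * v₂) := by
      intro c₂ v₂ h₂ hout
      have hhead : ∀ i, (prodCfg none (atRest c₁.inputHead c₂.inputHead) c₁ c₂
          c₂.output).workHead i ≤ B :=
        workHead_prodCfg_le hwork h₂.work_le (Nat.zero_le _) (Nat.zero_le _)
      have hleaf : (prod M₁ M₂).leafCount x y
          (prodCfg none (atRest c₁.inputHead c₂.inputHead) c₁ c₂ c₂.output) = 0 := by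
        refine if_neg ?_
        rintro ⟨-, ⟨-, h, -⟩, -⟩
        cases h
      rcases Set.eq_empty_or_nonempty (M₁.enabled x c₁) with he | he
      · by_cases hacc : c₁.state ∈ M₁.accept
        · refine .of_singleton (a := haltFst ⟨c₁.state, c₂.state, none, .run⟩
            (prodRead none (atRest c₁.inputHead c₂.inputHead) c₁ c₂)) hhead hinput ?_ ?_
          · rw [enabled_prodCfg_halted he rfl]
            simp [hacc]
            rfl
          · rw [next_haltFst, min_eq_left hinput]
            refine .of_swap hB h₂.input_le hinput hwork h₂.work_le ?_
            -- With `o = none` control never returns to the first machine, so the hypothesis on its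
            -- continuation is vacuous.
            exact .prod_snd hB h₁ none (fun _ _ h => absurd rfl h) (fun _ => ⟨he, hacc⟩) h₂
              (by simpa using hout)
        · have h := Tree.of_halted (y := y) hhead hinput (by
            rw [enabled_prodCfg_halted he rfl]
            simp [hacc]
            rfl)
          rw [hleaf] at h
          have h0 : M₁.leafCount x y c₁ = 0 := if_neg fun h => hacc h.2.1
          simpa [h0, he] using h
      · refine .of_image (liftFst_injective _ _) (fun a => w a * v₂) hhead hinput
          (enabled_prodCfg_fst he rfl) (fun a ha => ?_) ?_
        · rw [next_liftFst rfl]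
          cases hl : a.emit with
          | none => exact (ih a ha).1 _ _ h₂ (by simpa [NTM.next, hl] using hout)
          | some l =>
            refine .of_swap hB h₂.input_le (hnext a ha).input_le (hnext a ha).work_le
              h₂.work_le ?_
            exact (ih a ha).2 l _ _ h₂ (by simpa [NTM.next, hl] using hout)
        · rw [hleaf, leafCount_of_nonempty he, zero_add, zero_add, finsum_mem_mul]
    exact ⟨hA, fun l c₂ v₂ h₂ hout =>
      .prod_snd hB h₁ (some l) (fun c₂ v₂ _ => hA c₂ v₂) nofun h₂ hout⟩

theorem Tree.prod_init (hB : (x.length + 1).size ≤ B) {v₂ : ℕ}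
    (h₁ : M₁.Tree x y B M₁.init v₁) (h₂ : M₂.Tree x y B M₂.init v₂) :
    (prod M₁ M₂).Tree x y B (prod M₁ M₂).init (v₁ * v₂) := by
  have hinit : (prod M₁ M₂).init = prodCfg none
      ⟨.start, 0, fun _ => (false, none), 0, fun _ => (false, none), 0⟩ M₁.init M₂.init [] := by
    refine Cfg.ext_of_eq rfl rfl (fun (i : PTape M₁ M₂) => ?_) (fun (i : PTape M₁ M₂) => ?_) rfl
    · rcases i with i | i | (_ | _) <;> rfl
    · rcases i with i | i | (_ | _) <;> rfl
  have hmark : Function.update (fun _ => ((false, none) : CounterSymbol)) 0 (true, none) =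
      counterTape [] := by
    funext j
    rcases eq_or_ne j 0 with rfl | hj
    · rfl
    · simp [counterTape, hj]
  rw [hinit]
  -- A single bookkeeping step marks the cells 0 of both counters, which are then empty and
  -- represent head position 0.
  refine .of_reach (m' := atRest 0 0)
    (.head (m' := atRest 0 0) ⟨nofun, nofun, Nat.zero_le _, Nat.zero_le _, Nat.zero_le _⟩ ?_ .refl)
    h₁.work_le h₂.work_le ((h₁.prod_aux hB).1 _ _ h₂ rfl)
  simp [SwapCfg.next, SwapCfg.action, swapAction, Move.apply, atRest, hmark]

end Prod

end NTM

theorem IsLogCount.mul {α : Type} [Finite α] {g₁ g₂ : List α → List α → ℕ} (h₁ : IsLogCount g₁)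
    (h₂ : IsLogCount g₂) : IsLogCount fun x y => g₁ x y * g₂ x y := by
  obtain ⟨M₁, C₁, h₁⟩ := h₁
  obtain ⟨M₂, C₂, h₂⟩ := h₂
  -- The summand 2 makes room for the counters: a position up to `x.length + 1` has at most `Nat.log
  -- 2 x.length + 2` binary digits.
  refine ⟨NTM.prod M₁ M₂, C₁ + C₂ + 2, fun x y => .prod_init ?_ ((h₁ x y).mono ?_)
    ((h₂ x y).mono ?_)⟩
  · refine Nat.size_le.2 ?_
    have h := Nat.lt_pow_succ_log_self (b := 2) (by norm_num) x.length
    calc x.length + 1 ≤ 2 ^ (Nat.log 2 x.length + 1) := h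
      _ < 2 ^ ((C₁ + C₂ + 2) * Nat.log 2 x.length + (C₁ + C₂ + 2)) := by
        refine Nat.pow_lt_pow_right (by norm_num) ?_
        nlinarith [Nat.zero_le (Nat.log 2 x.length)]
  · gcongr <;> omega
  · gcongr <;> omega

end ModLog

/-! ### Sums of log counts -/

namespace ModLog

namespace NTM

variable {α : Type}

/-- Step-by-step simulation preserves computation trees. -/
theorem Tree.of_simulation {M N : NTM α} {x y : List α} {B : ℕ} (e : M.Cfg → N.Cfg)
    (f : M.Cfg → M.Act → N.Act) (hf : ∀ c, (f c).Injective)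
    (hwork : ∀ c, (∀ i, c.workHead i ≤ B) → ∀ i, (e c).workHead i ≤ B)
    (hinput : ∀ c, (e c).inputHead = c.inputHead)
    (henabled : ∀ c, N.enabled x (e c) = f c '' M.enabled x c)
    (hnext : ∀ c a, N.next x (e c) (f c a) = e (M.next x c a))
    (haccept : ∀ c, (e c).state ∈ N.accept ↔ c.state ∈ M.accept)
    (houtput : ∀ c, (e c).output = c.output) {c : M.Cfg} {v : ℕ} (h : M.Tree x y B c v) :
    N.Tree x y B (e c) v := by
  induction h with
  | intro c w hw hi _ ih =>
    refine .of_image (hf c) w (hwork c hw) ((hinput c).trans_le hi) (henabled c)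
      (fun a ha => hnext c a ▸ ih a ha) ?_
    congr 1
    have h : N.AcceptsAt x y (e c) ↔ M.AcceptsAt x y c := by
      rw [AcceptsAt, AcceptsAt, henabled, Set.image_eq_empty, haccept, houtput]
    by_cases hM : M.AcceptsAt x y c <;> simp [leafCount, h, hM]

section Sum

variable (M₁ M₂ : NTM α)

/-- Control states of the sum of `M₁` and `M₂`. -/
abbrev SState : Type := Option (M₁.Q ⊕ M₂.Q)

/-- Actions of the sum of `M₁` and `M₂`. -/
abbrev SAction : Type := Action α (SState M₁ M₂) (M₁.Γ × M₂.Γ) (M₁.ι ⊕ M₂.ι)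

variable {M₁ M₂}

/-- An action of the first machine as an action of the sum. -/
def sumLeft (r : M₁.ι ⊕ M₂.ι → M₁.Γ × M₂.Γ) (a : M₁.Act) : SAction M₁ M₂ where
  state := some (.inl a.state)
  write
    | .inl i => (a.write i, M₂.blank)
    | .inr i => r (.inr i)
  workMove
    | .inl i => a.workMove i
    | .inr _ => .stay
  inputMove := a.inputMove
  emit := a.emit

/-- An action of the second machine as an action of the sum. -/
def sumRight (r : M₁.ι ⊕ M₂.ι → M₁.Γ × M₂.Γ) (a : M₂.Act) : SAction M₁ M₂ where
  state := some (.inr a.state)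
  write
    | .inl i => r (.inl i)
    | .inr i => (M₁.blank, a.write i)
  workMove
    | .inl _ => .stay
    | .inr i => a.workMove i
  inputMove := a.inputMove
  emit := a.emit

theorem sumLeft_injective (r : M₁.ι ⊕ M₂.ι → M₁.Γ × M₂.Γ) :
    Function.Injective (sumLeft r) := by
  rintro ⟨s, w, m, i, e⟩ ⟨s', w', m', i', e'⟩ h
  simp only [sumLeft, Action.mk.injEq, Option.some.injEq, Sum.inl.injEq] at h
  obtain ⟨hs, hw, hm, hi, he⟩ := h
  have hw : w = w' := funext fun k => congrArg Prod.fst (congrFun hw (.inl k))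
  have hm : m = m' := funext fun k => congrFun hm (.inl k)
  subst hs he hw hm hi
  rfl

theorem sumRight_injective (r : M₁.ι ⊕ M₂.ι → M₁.Γ × M₂.Γ) :
    Function.Injective (sumRight r) := by
  rintro ⟨s, w, m, i, e⟩ ⟨s', w', m', i', e'⟩ h
  simp only [sumRight, Action.mk.injEq, Option.some.injEq, Sum.inr.injEq] at h
  obtain ⟨hs, hw, hm, hi, he⟩ := h
  have hw : w = w' := funext fun k => congrArg Prod.snd (congrFun hw (.inr k))
  have hm : m = m' := funext fun k => congrFun hm (.inr k)
  subst hs he hw hm hi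
  rfl

/-- The initial choice of one of the two machines. -/
def sumStart (q : M₁.Q ⊕ M₂.Q) : SAction M₁ M₂ where
  state := some q
  write := fun _ => (M₁.blank, M₂.blank)
  workMove := fun _ => .stay
  inputMove := .stay
  emit := none

/-- Transitions of the sum. -/
def sumTrans (q : SState M₁ M₂) (s : InputSymbol α) (r : M₁.ι ⊕ M₂.ι → M₁.Γ × M₂.Γ) :
    Set (SAction M₁ M₂) :=
  match q with
  | none => {sumStart (.inl M₁.start), sumStart (.inr M₂.start)}
  | some (.inl q) => sumLeft r '' M₁.trans q s (fun i => (r (.inl i)).1)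
  | some (.inr q) => sumRight r '' M₂.trans q s (fun i => (r (.inr i)).2)

variable (M₁ M₂) in
/-- The machine that runs one of two machines, chosen nondeterministically. -/
def sum : NTM α where
  Q := SState M₁ M₂
  Γ := M₁.Γ × M₂.Γ
  ι := M₁.ι ⊕ M₂.ι
  finiteQ := inferInstance
  finiteΓ := inferInstance
  finiteι := inferInstance
  start := none
  blank := (M₁.blank, M₂.blank)
  accept := some '' (Sum.inl '' M₁.accept ∪ Sum.inr '' M₂.accept)
  trans := sumTrans

variable (M₂) in
/-- A configuration of the first machine as a configuration of the sum. -/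
def sumCfgLeft (c : M₁.Cfg) : (sum M₁ M₂).Cfg where
  state := (some (.inl c.state) : SState M₁ M₂)
  inputHead := c.inputHead
  work
    | .inl i => fun j => (c.work i j, M₂.blank)
    | .inr _ => fun _ => (M₁.blank, M₂.blank)
  workHead
    | .inl i => c.workHead i
    | .inr _ => 0
  output := c.output

variable (M₁) in
/-- A configuration of the second machine as a configuration of the sum. -/
def sumCfgRight (c : M₂.Cfg) : (sum M₁ M₂).Cfg where
  state := (some (.inr c.state) : SState M₁ M₂)
  inputHead := c.inputHead
  work
    | .inl _ => fun _ => (M₁.blank, M₂.blank)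
    | .inr i => fun j => (M₁.blank, c.work i j)
  workHead
    | .inl _ => 0
    | .inr i => c.workHead i
  output := c.output

variable {x y : List α} {B v₁ v₂ : ℕ}

theorem Tree.sumLeft {c : M₁.Cfg} (h : M₁.Tree x y B c v₁) :
    (sum M₁ M₂).Tree x y B (sumCfgLeft M₂ c) v₁ := by
  refine h.of_simulation (sumCfgLeft M₂)
    (fun c => NTM.sumLeft fun i => (sumCfgLeft M₂ c).work i ((sumCfgLeft M₂ c).workHead i))
    (fun c => sumLeft_injective _) (fun c hc (i : M₁.ι ⊕ M₂.ι) => ?_) (fun _ => rfl)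
    (fun _ => rfl) (fun c a => ?_) (fun c => ?_) (fun _ => rfl)
  · rcases i with i | i
    · exact hc i
    · exact Nat.zero_le _
  · refine Cfg.ext_of_eq rfl rfl (fun (i : M₁.ι ⊕ M₂.ι) => ?_) (fun (i : M₁.ι ⊕ M₂.ι) => ?_) rfl
    · rcases i with i | i
      · exact (Function.comp_update (fun s => (s, M₂.blank)) _ _ _).symm
      · exact Function.update_eq_self _ _
    · rcases i with i | i <;> rfl
  · exact (by simp : (some (.inl c.state) : SState M₁ M₂) ∈
      some '' (Sum.inl '' M₁.accept ∪ Sum.inr '' M₂.accept) ↔ c.state ∈ M₁.accept)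

theorem Tree.sumRight {c : M₂.Cfg} (h : M₂.Tree x y B c v₂) :
    (sum M₁ M₂).Tree x y B (sumCfgRight M₁ c) v₂ := by
  refine h.of_simulation (sumCfgRight M₁)
    (fun c => NTM.sumRight fun i => (sumCfgRight M₁ c).work i ((sumCfgRight M₁ c).workHead i))
    (fun c => sumRight_injective _) (fun c hc (i : M₁.ι ⊕ M₂.ι) => ?_) (fun _ => rfl)
    (fun _ => rfl) (fun c a => ?_) (fun c => ?_) (fun _ => rfl)
  · rcases i with i | i
    · exact Nat.zero_le _
    · exact hc i
  · refine Cfg.ext_of_eq rfl rfl (fun (i : M₁.ι ⊕ M₂.ι) => ?_) (fun (i : M₁.ι ⊕ M₂.ι) => ?_) rfl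
    · rcases i with i | i
      · exact Function.update_eq_self _ _
      · exact (Function.comp_update (fun s => (M₁.blank, s)) _ _ _).symm
    · rcases i with i | i <;> rfl
  · exact (by simp : (some (.inr c.state) : SState M₁ M₂) ∈
      some '' (Sum.inl '' M₁.accept ∪ Sum.inr '' M₂.accept) ↔ c.state ∈ M₂.accept)

/-- The tag keeps the two initial choices distinct even if `M₁` and `M₂` coincide; otherwise the set
of transitions would merge them and the counts would not add. -/
theorem sumStart_injective : Function.Injective (sumStart (M₁ := M₁) (M₂ := M₂)) :=
  fun _ _ h => Option.some.inj (congrArg Action.state h)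

theorem Tree.sum_init (h₁ : M₁.Tree x y B M₁.init v₁) (h₂ : M₂.Tree x y B M₂.init v₂) :
    (sum M₁ M₂).Tree x y B (sum M₁ M₂).init (v₁ + v₂) := by
  refine .of_image (S := {.inl M₁.start, .inr M₂.start}) sumStart_injective
    (Sum.elim (fun _ => v₁) (fun _ => v₂)) (fun _ => Nat.zero_le _) (Nat.zero_le _)
    (Set.image_pair _ _ _).symm ?_ ?_
  · rintro _ (rfl | rfl)
    · have : (sum M₁ M₂).next x (sum M₁ M₂).init (sumStart (.inl M₁.start)) =
          sumCfgLeft M₂ M₁.init := by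
        refine Cfg.ext_of_eq rfl rfl (fun (i : M₁.ι ⊕ M₂.ι) => ?_)
          (fun (i : M₁.ι ⊕ M₂.ι) => ?_) rfl
        · refine (Function.update_eq_self _ _).trans ?_
          rcases i with i | i <;> rfl
        · rcases i with i | i <;> rfl
      exact this ▸ h₁.sumLeft
    · have : (sum M₁ M₂).next x (sum M₁ M₂).init (sumStart (.inr M₂.start)) =
          sumCfgRight M₁ M₂.init := by
        refine Cfg.ext_of_eq rfl rfl (fun (i : M₁.ι ⊕ M₂.ι) => ?_)
          (fun (i : M₁.ι ⊕ M₂.ι) => ?_) rfl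
        · refine (Function.update_eq_self _ _).trans ?_
          rcases i with i | i <;> rfl
        · rcases i with i | i <;> rfl
      exact this ▸ h₂.sumRight
  · have hleaf : (sum M₁ M₂).leafCount x y (sum M₁ M₂).init = 0 := by
      refine if_neg ?_
      rintro ⟨-, ⟨_, _, h⟩, -⟩
      cases h
    rw [hleaf, finsum_mem_pair (by simp)]
    simp

end Sum

/-- A machine that halts immediately and rejects. -/
def reject (α : Type) : NTM α where
  Q := Unit
  Γ := Unit
  ι := Empty
  finiteQ := inferInstance
  finiteΓ := inferInstance
  finiteι := inferInstance
  start := ()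
  blank := ()
  accept := ∅
  trans := fun _ _ _ => ∅

end NTM

/-! ### Closure properties, lifting to prime powers and the Chinese remainder theorem -/

namespace IsLogCount

variable {α : Type} {g₁ g₂ : List α → List α → ℕ}

theorem add (h₁ : IsLogCount g₁) (h₂ : IsLogCount g₂) :
    IsLogCount fun x y => g₁ x y + g₂ x y := by
  obtain ⟨M₁, C₁, h₁⟩ := h₁
  obtain ⟨M₂, C₂, h₂⟩ := h₂
  refine ⟨NTM.sum M₁ M₂, C₁ + C₂, fun x y => .sum_init ((h₁ x y).mono ?_) ((h₂ x y).mono ?_)⟩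
  · gcongr <;> omega
  · gcongr <;> omega

theorem zero : IsLogCount fun _ _ : List α => 0 := by
  refine ⟨NTM.reject α, 0, fun x y => ?_⟩
  have h := NTM.Tree.of_halted (M := NTM.reject α) (c := (NTM.reject α).init) (x := x) (y := y)
    (B := 0 * Nat.log 2 x.length + 0) nofun (Nat.zero_le _) rfl
  rwa [NTM.leafCount, if_neg (fun h => h.2.1)] at h

theorem const_mul (h : IsLogCount g₁) (n : ℕ) : IsLogCount fun x y => n * g₁ x y := by
  induction n with
  | zero => simpa using zero
  | succ n ih => simpa [add_mul] using ih.add h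

theorem sum {ι : Type*} (s : Finset ι) {g : ι → List α → List α → ℕ}
    (h : ∀ j, IsLogCount (g j)) : IsLogCount fun x y => ∑ j ∈ s, g j x y := by
  classical
  induction s using Finset.induction_on with
  | empty => simpa using zero
  | insert a s ha ih => simpa [Finset.sum_insert ha] using (h a).add ih

/-- The exponent 0 is excluded: a halting machine has finitely many branches on each input, so the
constant 1 is not a log count when there are infinitely many strings `y`. -/
theorem pow [Finite α] (h : IsLogCount g₁) {n : ℕ} (hn : 1 ≤ n) :
    IsLogCount fun x y => g₁ x y ^ n := by
  induction n, hn using Nat.le_induction with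
  | base => simpa using h
  | succ n _ ih => simpa [pow_succ] using ih.mul h

end IsLogCount

/-- By the binomial theorem, each further `p`-th power of two numbers congruent modulo `p` gains
another factor `p` in their difference. -/
theorem modEq_pow_pow {p a b : ℕ} (h : a ≡ b [MOD p]) (n : ℕ) :
    a ^ p ^ n ≡ b ^ p ^ n [MOD p ^ (n + 1)] := by
  refine Nat.modEq_iff_dvd.2 ?_
  have := dvd_sub_pow_of_dvd_sub (R := ℤ) (Nat.modEq_iff_dvd.1 h) n
  exact_mod_cast this

/-- Idempotents of the Chinese remainder theorem. -/
theorem exists_modEq_one_and_dvd {ι : Type*} [DecidableEq ι] (s : Finset ι) (m : ι → ℕ)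
    (hm : (s : Set ι).Pairwise (Function.onFun Nat.Coprime m)) {j : ι} (hj : j ∈ s) :
    ∃ c : ℕ, c ≡ 1 [MOD m j] ∧ ∀ i ∈ s, i ≠ j → m i ∣ c := by
  have hcop : Nat.Coprime (m j) (∏ i ∈ s.erase j, m i) :=
    Nat.Coprime.prod_right fun i hi =>
      hm hj (Finset.mem_of_mem_erase hi) (Finset.ne_of_mem_erase hi).symm
  obtain ⟨c, h1, h0⟩ := Nat.chineseRemainder hcop 1 0
  exact ⟨c, h1, fun i hi hij => (Finset.dvd_prod_of_mem m (Finset.mem_erase.2 ⟨hij, hi⟩)).trans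
    ((Nat.modEq_zero_iff_dvd).1 h0)⟩

theorem FUL_anti {α : Type} {k m : ℕ} (h : m ∣ k) : FUL α k ⊆ FUL α m := by
  rintro f ⟨M, h1, h2, h3, h4⟩
  exact ⟨M, h1, h2, fun x y hy => (h3 x y hy).of_dvd h, fun x y hy => (h4 x y hy).of_dvd h⟩

theorem mem_FUL_iff {α : Type} [Finite α] {k : ℕ} {f : List α →. List α} :
    f ∈ FUL α k ↔ ∃ g, IsLogCount g ∧ (∀ x y, y ∈ f x → g x y ≡ 1 [MOD k]) ∧
      ∀ x y, y ∉ f x → g x y ≡ 0 [MOD k] := by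
  constructor
  · rintro ⟨M, h1, h2, h3, h4⟩
    exact ⟨M.count, M.isLogCount_count h1 h2, h3, h4⟩
  · rintro ⟨g, hg, h3, h4⟩
    obtain ⟨M, h1, h2, rfl⟩ := hg.exists_machine
    exact ⟨M, h1, h2, h3, h4⟩

theorem FUL_prod_pow_eq_iInter {α ι : Type} [Finite α] [Fintype ι] (p e : ι → ℕ)
    (hp : ∀ j, (p j).Prime) (hinj : Function.Injective p) (he : ∀ j, 1 ≤ e j) :
    FUL α (∏ j, p j ^ e j) = ⋂ j, FUL α (p j) := by
  classical
  refine Set.Subset.antisymm (Set.subset_iInter fun j => FUL_anti ?_) fun f hf => ?_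
  · exact (dvd_pow_self _ (Nat.one_le_iff_ne_zero.1 (he j))).trans
      (Finset.dvd_prod_of_mem (fun j => p j ^ e j) (Finset.mem_univ j))
  have hcop : Pairwise (Function.onFun Nat.Coprime fun j => p j ^ e j) := fun i j hij =>
    Nat.Coprime.pow _ _ ((Nat.coprime_primes (hp i) (hp j)).2 (hinj.ne hij))
  have hc := fun j => exists_modEq_one_and_dvd Finset.univ _ (hcop.set_pairwise _)
    (Finset.mem_univ j)
  choose c hc1 hc0 using hc
  have hf' : ∀ j, f ∈ FUL α (p j) := Set.mem_iInter.1 hf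
  simp only [mem_FUL_iff] at hf'
  choose g hg hg1 hg0 using hf'
  -- The condition on `a` holds exactly for 0 and 1, so both requirements on the count are treated
  -- at once.
  have key : ∀ (x y : List α) (a : ℕ), (∀ n, 1 ≤ n → a ^ n = a) →
      (∀ j, g j x y ≡ a [MOD p j]) →
      ∑ j, c j * g j x y ^ p j ^ (e j - 1) ≡ a [MOD ∏ j, p j ^ e j] := by
    intro x y a ha h
    have hj : ∀ j, ∑ i, c i * g i x y ^ p i ^ (e i - 1) ≡ a [MOD p j ^ e j] := by
      intro j
      -- Modulo `p j ^ e j` only the term with index `j` survives, as the other coefficients are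
      -- divisible by this modulus.
      rw [← Finset.add_sum_erase _ _ (Finset.mem_univ j)]
      have h1 : c j * g j x y ^ p j ^ (e j - 1) ≡ 1 * a [MOD p j ^ e j] := by
        refine (hc1 j).mul ?_
        have := modEq_pow_pow (h j) (e j - 1)
        rwa [Nat.sub_add_cancel (he j), ha _ (Nat.one_le_pow _ _ (hp j).pos)] at this
      have h0 : ∑ i ∈ Finset.univ.erase j, c i * g i x y ^ p i ^ (e i - 1) ≡ 0
          [MOD p j ^ e j] := by
        refine Nat.modEq_zero_iff_dvd.2 (Finset.dvd_sum fun i hi => ?_)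
        exact (hc0 i j (Finset.mem_univ j) (Finset.ne_of_mem_erase hi).symm).mul_right _
      simpa using h1.add h0
    refine Nat.modEq_iff_dvd.2 ?_
    push_cast
    refine Finset.prod_dvd_of_coprime (fun i _ j _ hij => ?_) fun j _ => ?_
    · have := Nat.isCoprime_iff_coprime.2 (hcop hij)
      simpa [Function.onFun] using this
    · exact_mod_cast Nat.modEq_iff_dvd.1 (hj j)
  refine mem_FUL_iff.2 ⟨_, .sum Finset.univ fun j =>
    ((hg j).pow (Nat.one_le_pow (e j - 1) _ (hp j).pos)).const_mul (c j), ?_, ?_⟩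
  · exact fun x y hy => key x y 1 (fun n _ => one_pow n) fun j => hg1 j x y hy
  · exact fun x y hy => key x y 0 (fun n hn => zero_pow (by omega)) fun j => hg0 j x y hy

end ModLog

theorem mainTheorem5 {α : Type} [Finite α] (k : ℕ) (hk : 2 ≤ k)
    (l : ℕ) (p e : Fin l → ℕ) (hp : ∀ j, (p j).Prime) (hinj : Function.Injective p)
    (he : ∀ j, 1 ≤ e j) (hfac : k = ∏ j, p j ^ e j) :
    (ModLog.FUL α k = ⋂ j, ModLog.FUL α (p j)) ∧
      ModLog.FUL α k = ModLog.FUL α (∏ j, p j) := by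
  have h := ModLog.FUL_prod_pow_eq_iInter (α := α) p e hp hinj he
  have h' := ModLog.FUL_prod_pow_eq_iInter (α := α) p (fun _ => 1) hp hinj fun _ => le_rfl
  simp only [pow_one] at h'
  rw [hfac]
  exact ⟨h, h.trans h'.symm⟩
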